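/- Let $N_C$ (with $\top\in N_C$), $N_R$, $N_I$, $N_S$ be disjoint countably infinite sets of concept names, role names, individuals and shape names; a \emph{role} is $p$ or $p^-$ with $p\in N_R$. A \emph{data graph} $\mathcal G$ is a (possibly infinite) set of assertions $A(a)$, $p(a,b)$ with $A\in N_C$, $p\in N_R$, $a,b\in N_I$; its nodes $\Delta^{\mathcal G}$ are the individuals that appear in it, $A^{\mathcal G}=\{a\mid A(a)\in\mathcal G\}$ for $A\ne\top$, $\top^{\mathcal G}=\Delta^{\mathcal G}$, $p^{\mathcal G}=\{(a,b)\mid p(a,b)\in\mathcal G\}$, and $(p^-)^{\mathcal G}$ is the converse of $p^{\mathcal G}$. $\mathcal{ALCIO}$ shape expressions are given by $$\varphi ::= s\mid a\mid A\mid \neg s\mid \varphi\wedge\varphi\mid\varphi\vee\varphi\mid\forall r.\varphi\mid\exists r.\varphi$$ with $s\in N_S$, $a\in N_I$, $A\in N_C$ and $r$ a role. A constraint set $\mathcal C$ is a finite set of constraints $s\leftarrow\varphi$ in which each shape name is the head of at most one constraint. It is \emph{stratified} if it can be partitioned into $\mathcal C_0,\dots,\mathcal C_k$ such that, for every $s\leftarrow\varphi\in\mathcal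 C_i$: (1) if $i<k$, every shape name occurring in $\varphi$ is the head of a constraint in $\mathcal C_0\cup\dots\cup\mathcal C_i$; (2) every $s'$ such that $\neg s'$ occurs in $\varphi$ is the head of a constraint in $\mathcal C_0\cup\dots\cup\mathcal C_{i-1}$. A \emph{supported model} of $\mathcal G$ and $\mathcal C$ is a consistent set $S$ of literals $s(a)$, $\neg s(a)$ that decides every shape name at every node of $\mathcal G$ and satisfies $\{a\mid s(a)\in S\}=[\![\varphi]\!]$ for every $s\leftarrow\varphi\in\mathcal C$. Here $[\![s]\!]=\{a\mid s(a)\in S\}$, $[\![\neg s]\!]=\{a\mid\neg s(a)\in S\}$, $[\![a]\!]=\{a\}$, $[\![A]\!]=A^{\mathcal G}$, $\wedge$ and $\vee$ are intersection and union, and $\forall r.\varphi$, $\exists r.\varphi$ hold at the nodes all of whose, respectively at least one of whose, $r$-successors lie in $[\![\varphi]\!]$. A node $a$ of $\mathcal G$ \emph{satisfies} $(\mathcal C,s)$ if $s(a)\in S$ for some supported model $S$ of $\mathcal G$ and $\mathcal C$. Finally, $(\mathcal C_1,s_1)$ \emph{implies} $(\mathcal C_2,s_2)$ if, in every data graph in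 which all individuals mentioned in $\mathcal C_1$ and $\mathcal C_2$ appear, every node that satisfies $(\mathcal C_1,s_1)$ also satisfies $(\mathcal C_2,s_2)$. \textbf{Theorem.} Shape implication with respect to constraints for $\mathcal{ALCIO}$ SHACL under the supported model semantics is undecidable: there is no algorithm that, given constraint sets $\mathcal C_1,\mathcal C_2$ and shape names $s_1,s_2$, decides whether $(\mathcal C_1,s_1)$ implies $(\mathcal C_2,s_2)$. This remains true when the inputs are restricted to stratified $\mathcal C_1$ and $\mathcal C_2$. -/

import Mathlib

namespace SHACL

/-! ### Names, roles, data graphs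

The four sets of names are countably infinite. They are kept disjoint by the constructors through
which names enter atoms, expressions and targets. -/

abbrev ConceptName := ℕ
abbrev RoleName := ℕ
abbrev Individual := ℕ
abbrev ShapeName := ℕ

/-- The concept name `⊤`. -/
def topConcept : ConceptName := 0

/-- Roles: a role name `p` or an inverse `p⁻`. -/
inductive Role where
  | name (p : RoleName)
  | inv (p : RoleName)

/-- Assertions `A(a)` and `p(a, b)`. -/
inductive Atom where
  | concept (A : ConceptName) (a : Individual)
  | role (p : RoleName) (a b : Individual)

/-- A (possibly infinite) data graph: a set of assertions. -/
abbrev DataGraph := Set Atom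

namespace DataGraph

/-- The individuals that appear in the graph. -/
def nodes (G : DataGraph) : Set Individual :=
  {a | (∃ A, Atom.concept A a ∈ G) ∨ (∃ p b, Atom.role p a b ∈ G) ∨ ∃ p b, Atom.role p b a ∈ G}

/-- The extension of a concept name; `⊤` holds at every node. -/
def conceptExt (G : DataGraph) (A : ConceptName) : Set Individual :=
  {a | Atom.concept A a ∈ G ∨ (A = topConcept ∧ a ∈ G.nodes)}

/-- The extension of a role. -/
def roleExt (G : DataGraph) : Role → Set (Individual × Individual)
  | .name p => {x | Atom.role p x.1 x.2 ∈ G}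
  | .inv p => {x | Atom.role p x.2 x.1 ∈ G}

end DataGraph

/-! ### Syntax of ALCIO SHACL -/

/-- ALCIO shape expressions
`φ ::= s | a | A | ¬s | φ ∧ φ | φ ∨ φ | ∀ r.φ | ∃ r.φ`. -/
inductive ShapeExpr where
  | shape (s : ShapeName)
  | ind (a : Individual)
  | concept (A : ConceptName)
  | negShape (s : ShapeName)
  | and (φ ψ : ShapeExpr)
  | or (φ ψ : ShapeExpr)
  | all (r : Role) (φ : ShapeExpr)
  | ex (r : Role) (φ : ShapeExpr)

namespace ShapeExpr

/-- Subexpressions; note that `s` is a subexpression of `¬s`. -/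
def sub : ShapeExpr → Set ShapeExpr
  | shape s => {shape s}
  | ind a => {ind a}
  | concept A => {concept A}
  | negShape s => {negShape s, shape s}
  | and φ ψ => {and φ ψ} ∪ sub φ ∪ sub ψ
  | or φ ψ => {or φ ψ} ∪ sub φ ∪ sub ψ
  | all r φ => {all r φ} ∪ sub φ
  | ex r φ => {ex r φ} ∪ sub φ

/-- The individuals that appear in an expression. -/
def individuals : ShapeExpr → Set Individual
  | shape _ => ∅
  | ind a => {a}
  | concept _ => ∅
  | negShape _ => ∅
  | and φ ψ => individuals φ ∪ individuals ψ
  | or φ ψ => individuals φ ∪ individuals ψ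
  | all _ φ => individuals φ
  | ex _ φ => individuals φ

end ShapeExpr

/-- A shape constraint `s ← φ`, as the pair `(s, φ)`. -/
abbrev Constraint := ShapeName × ShapeExpr

/-- A finite set of constraints, given by a list of its elements. -/
abbrev ConstraintSet := List Constraint

namespace ConstraintSet

/-- No shape name is the head of two constraints (and no constraint is listed twice). -/
def UniqueHeads (C : ConstraintSet) : Prop := (C.map Prod.fst).Nodup

/-- `C` can be partitioned into `C₀, …, C_k` (the constraint `c` lies in the part `part c`) such
that for every `s ← φ` in `C_i`: if `i < k`, every shape name `s' ∈ sub φ` is defined in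
`C₀ ∪ … ∪ C_i`; and whenever `¬s' ∈ sub φ`, `s'` is defined in `C₀ ∪ … ∪ C_{i-1}`. -/
def Stratified (C : ConstraintSet) : Prop :=
  ∃ (k : ℕ) (part : Constraint → ℕ), (∀ c ∈ C, part c ≤ k) ∧
    ∀ c ∈ C,
      (part c < k → ∀ s', ShapeExpr.shape s' ∈ c.2.sub →
        ∃ d ∈ C, d.1 = s' ∧ part d ≤ part c) ∧
      (∀ s', ShapeExpr.negShape s' ∈ c.2.sub →
        ∃ d ∈ C, d.1 = s' ∧ part d < part c)

end ConstraintSet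

/-- Targets `(ℓ, s)`, where `ℓ` is an individual, a concept name or a role. -/
inductive Target where
  | node (a : Individual) (s : ShapeName)
  | concept (A : ConceptName) (s : ShapeName)
  | role (r : Role) (s : ShapeName)

/-- A SHACL document `(𝒞, 𝒯)`. -/
structure Document where
  constraints : ConstraintSet
  targets : List Target

/-- The individuals that appear in a document. -/
def Document.individuals (D : Document) : Set Individual :=
  {a | (∃ c ∈ D.constraints, a ∈ c.2.individuals) ∨ ∃ s, Target.node a s ∈ D.targets}

/-- `G` is compatible with `D`: all individuals that appear in `D` also appear in `G`. -/
def Compatible (G : DataGraph) (D : Document) : Prop := D.individuals ⊆ G.nodes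

/-! ### Shape assignments and semantics -/

/-- Shape literals `s(a)` and `¬s(a)`. -/
inductive ShapeLiteral where
  | pos (s : ShapeName) (a : Individual)
  | neg (s : ShapeName) (a : Individual)

/-- A shape assignment: a set of shape literals without contradictory pairs. -/
structure ShapeAssignment where
  lits : Set ShapeLiteral
  consistent : ∀ s a, ¬ (ShapeLiteral.pos s a ∈ lits ∧ ShapeLiteral.neg s a ∈ lits)

/-- `S` is total on `G`: every shape name has a truth value at every node of `G`. -/
def ShapeAssignment.Total (S : ShapeAssignment) (G : DataGraph) : Prop :=
  ∀ s, ∀ a ∈ G.nodes, ShapeLiteral.pos s a ∈ S.lits ∨ ShapeLiteral.neg s a ∈ S.lits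

/-- `⟦φ⟧`: the set of nodes at which `φ` is certainly validated, given the literals in `S`. -/
def eval (G : DataGraph) (S : ShapeAssignment) : ShapeExpr → Set Individual
  | .shape s => {a | ShapeLiteral.pos s a ∈ S.lits}
  | .ind a => {a}
  | .concept A => G.conceptExt A
  | .negShape s => {a | ShapeLiteral.neg s a ∈ S.lits}
  | .and φ ψ => eval G S φ ∩ eval G S ψ
  | .or φ ψ => eval G S φ ∪ eval G S ψ
  | .all r φ => {a | a ∈ G.nodes ∧ ∀ b ∈ G.nodes, (a, b) ∈ G.roleExt r → b ∈ eval G S φ}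
  | .ex r φ => {a | a ∈ G.nodes ∧ ∃ b, (a, b) ∈ G.roleExt r ∧ b ∈ eval G S φ}

/-- `G` validates a set of targets under the assignment `S`. -/
def ValidatesTargets (G : DataGraph) (S : ShapeAssignment) (T : List Target) : Prop :=
  (∀ a s, Target.node a s ∈ T → ShapeLiteral.pos s a ∈ S.lits) ∧
  (∀ A s, Target.concept A s ∈ T → ∀ a ∈ G.conceptExt A, ShapeLiteral.pos s a ∈ S.lits) ∧
  (∀ r s, Target.role r s ∈ T → ∀ a b, (a, b) ∈ G.roleExt r → ShapeLiteral.pos s a ∈ S.lits)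

/-- `S` is a supported model of `G` and `C`: it is total and, for every `s ← φ` in `C`, the nodes
at which `S` validates `s` are exactly those in `⟦φ⟧`. -/
def IsSupportedModel (G : DataGraph) (C : ConstraintSet) (S : ShapeAssignment) : Prop :=
  S.Total G ∧ ∀ c ∈ C, eval G S (.shape c.1) = eval G S c.2

/-- `G` satisfies the document `D` under the supported model semantics (brave validation). -/
def Satisfies (G : DataGraph) (D : Document) : Prop :=
  ∃ S, IsSupportedModel G D.constraints S ∧ ValidatesTargets G S D.targets

/-- The document `(𝒞, s(a))`. -/
def nodeDoc (C : ConstraintSet) (s : ShapeName) (a : Individual) : Document :=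
  ⟨C, [Target.node a s]⟩

/-- `(C₁, s₁)` implies `(C₂, s₂)` under the supported model semantics: in every graph, every node
that satisfies `(C₁, s₁)` also satisfies `(C₂, s₂)`. Only graphs compatible with the documents
are considered. -/
def ShapeImplies (C₁ : ConstraintSet) (s₁ : ShapeName) (C₂ : ConstraintSet) (s₂ : ShapeName) :
    Prop :=
  ∀ G : DataGraph, ∀ a ∈ G.nodes,
    Compatible G (nodeDoc C₁ s₁ a) → Compatible G (nodeDoc C₂ s₂ a) →
      Satisfies G (nodeDoc C₁ s₁ a) → Satisfies G (nodeDoc C₂ s₂ a)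

/-! ### Instances as inputs of algorithms

Shape expressions are coded effectively by natural numbers: the remainder modulo 8 tells the
constructor, and the quotient codes its arguments by means of the Cantor pairing function. -/

namespace Role

def code : Role → ℕ
  | name p => 2 * p
  | inv p => 2 * p + 1

def ofCode (n : ℕ) : Role := if n % 2 = 0 then name (n / 2) else inv (n / 2)

theorem ofCode_code (r : Role) : ofCode r.code = r := by
  cases r with
  | name p => simp [code, ofCode]
  | inv p =>
    have h : ∀ m : ℕ, (2 * m + 1) / 2 = m := fun m => by omega
    simp [code, ofCode, h]

theorem code_ofCode (n : ℕ) : (ofCode n).code = n := by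
  unfold ofCode
  split_ifs with h
  · show 2 * (n / 2) = n
    omega
  · show 2 * (n / 2) + 1 = n
    omega

end Role

namespace ShapeExpr

def code : ShapeExpr → ℕ
  | shape s => 8 * s
  | ind a => 8 * a + 1
  | concept A => 8 * A + 2
  | negShape s => 8 * s + 3
  | and φ ψ => 8 * Nat.pair φ.code ψ.code + 4
  | or φ ψ => 8 * Nat.pair φ.code ψ.code + 5
  | all r φ => 8 * Nat.pair r.code φ.code + 6
  | ex r φ => 8 * Nat.pair r.code φ.code + 7

def ofCode (n : ℕ) : ShapeExpr :=
  if h0 : n % 8 = 0 then shape (n / 8)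
  else if n % 8 = 1 then ind (n / 8)
  else if n % 8 = 2 then concept (n / 8)
  else if n % 8 = 3 then negShape (n / 8)
  else if h4 : n % 8 = 4 then
    have h1 : (n / 8).unpair.1 < n :=
      (Nat.unpair_left_le _).trans_lt (Nat.div_lt_self (by omega) (by norm_num))
    have h2 : (n / 8).unpair.2 < n :=
      (Nat.unpair_right_le _).trans_lt (Nat.div_lt_self (by omega) (by norm_num))
    and (ofCode (n / 8).unpair.1) (ofCode (n / 8).unpair.2)
  else if h5 : n % 8 = 5 then
    have h1 : (n / 8).unpair.1 < n :=
      (Nat.unpair_left_le _).trans_lt (Nat.div_lt_self (by omega) (by norm_num))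
    have h2 : (n / 8).unpair.2 < n :=
      (Nat.unpair_right_le _).trans_lt (Nat.div_lt_self (by omega) (by norm_num))
    or (ofCode (n / 8).unpair.1) (ofCode (n / 8).unpair.2)
  else if h6 : n % 8 = 6 then
    have h2 : (n / 8).unpair.2 < n :=
      (Nat.unpair_right_le _).trans_lt (Nat.div_lt_self (by omega) (by norm_num))
    all (Role.ofCode (n / 8).unpair.1) (ofCode (n / 8).unpair.2)
  else
    have h2 : (n / 8).unpair.2 < n :=
      (Nat.unpair_right_le _).trans_lt
        (Nat.div_lt_self (by omega) (by norm_num))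
    ex (Role.ofCode (n / 8).unpair.1) (ofCode (n / 8).unpair.2)

theorem mul_add_div_eight (m k : ℕ) (hk : k < 8) : (8 * m + k) / 8 = m := by omega

theorem mul_add_mod_eight (m k : ℕ) (hk : k < 8) : (8 * m + k) % 8 = k := by omega

theorem ofCode_code (φ : ShapeExpr) : ofCode φ.code = φ := by
  induction φ <;> rw [ofCode] <;>
    simp [code, mul_add_div_eight, Role.ofCode_code, Nat.add_mod, *]

theorem code_ofCode (n : ℕ) : (ofCode n).code = n := by
  induction n using Nat.strong_induction_on with
  | _ n ih =>
    have hlt : n ≠ 0 → n / 8 < n := fun h => Nat.div_lt_self (by omega) (by norm_num)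
    have hl : n ≠ 0 → (ofCode (n / 8).unpair.1).code = (n / 8).unpair.1 := fun h =>
      ih _ ((Nat.unpair_left_le _).trans_lt (hlt h))
    have hr : n ≠ 0 → (ofCode (n / 8).unpair.2).code = (n / 8).unpair.2 := fun h =>
      ih _ ((Nat.unpair_right_le _).trans_lt (hlt h))
    rw [ofCode]
    split_ifs with h0 h1 h2 h3 h4 h5 h6 <;> simp only [code, Role.code_ofCode]
    · omega
    · omega
    · omega
    · omega
    · rw [hl (by omega), hr (by omega), Nat.pair_unpair]; omega
    · rw [hl (by omega), hr (by omega), Nat.pair_unpair]; omega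
    · rw [hr (by omega), Nat.pair_unpair]; omega
    · rw [hr (by omega), Nat.pair_unpair]; omega

instance instDenumerable : Denumerable ShapeExpr :=
  Denumerable.mk' ⟨code, ofCode, ofCode_code, code_ofCode⟩

end ShapeExpr

/-- The inputs `((C₁, s₁), (C₂, s₂))` of the shape implication problem. -/
abbrev ImplicationInput := (ConstraintSet × ShapeName) × (ConstraintSet × ShapeName)

namespace ImplicationInput

/-- In both constraint sets, each shape name is the head of at most one constraint. -/
def WellFormed (x : ImplicationInput) : Prop :=
  ConstraintSet.UniqueHeads x.1.1 ∧ ConstraintSet.UniqueHeads x.2.1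

/-- Both constraint sets are stratified. -/
def Stratified (x : ImplicationInput) : Prop :=
  ConstraintSet.Stratified x.1.1 ∧ ConstraintSet.Stratified x.2.1

/-- The question: does `(C₁, s₁)` imply `(C₂, s₂)`? -/
def Implies (x : ImplicationInput) : Prop := ShapeImplies x.1.1 x.1.2 x.2.1 x.2.2

end ImplicationInput

/-- The question `Q`, asked for the inputs that satisfy `P`, is decidable: some algorithm halts on
every input that satisfies `P` and answers `Q` correctly there. -/
def DecidableProblem {α : Type*} [Primcodable α] (P Q : α → Prop) : Prop :=
  ∃ f : α →. Bool, Partrec f ∧ ∀ x, P x → ∃ b ∈ f x, (b = true ↔ Q x)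

end SHACL

/-! The halting problem reduces to implication by the empty constraint set. Under supported models a
constraint `s ← s` leaves `s` free, so satisfaction of the second constraint set is existential
monadic second-order: some valuation, with shape 3 fixed to a concept name, makes `Failure` true at
the target. A counterexample to the implication is thus a graph with a target at which, for every
valuation whose shape 2 contains the domain, all rules hold and the goal fails.

Quantification over valuations turns modal rules into first-order existence statements: shapes 0 and
1, chosen as singletons, act as variables, so validity of `ex r (var 0)` → `ex t (var 0)` says that
`r`-successors are `t`-successors. Such rules describe lists of numbers and the input-output
relation of every subcode of a code `c`. If `c` halts on `[n]`, valid rules force an output at each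
point standing for `[n]`, so `haltRule` holds (`exists_failure_of_dom`). If not, the actual lists
with the actual evaluation relations obey the rules and violate `haltRule` (`not_failure_listRel`).
The rules only demand witnesses, so it is harmless that in an arbitrary graph a point may stand for
several lists.

Shape expressions have no global quantifier; `domRole` lets the target see its domain instead.
Choosing shape 2 equal to the domain keeps new witnesses inside it, where the rules apply again. The
code `c` is fixed, with undecidable halting problem, so only the premise of `haltRule` varies with
the input. -/

namespace SHACL

/-! ### Positive formulas and their complements as shape expressions. -/

/-- Positive existential shape expressions over the four shape names `0, …, 3`. -/
inductive PosExpr where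
  | var (i : Fin 4)
  | and (φ ψ : PosExpr)
  | ex (p : RoleName) (φ : PosExpr)

namespace PosExpr

/-- The shape expression for `φ`. -/
def toPos : PosExpr → ShapeExpr
  | var i => .shape i
  | and φ ψ => .and φ.toPos ψ.toPos
  | ex p φ => .ex (.name p) φ.toPos

/-- A shape expression for the complement of `φ`. -/
def toNeg : PosExpr → ShapeExpr
  | var i => .negShape i
  | and φ ψ => .or φ.toNeg ψ.toNeg
  | ex p φ => .all (.name p) φ.toNeg

/-- Truth of `φ` at a point of a Kripke structure with valuation `V`. -/
def Sat {α : Type*} (R : RoleName → α → α → Prop) (V : Fin 4 → Set α) : PosExpr → α → Prop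
  | var i, x => x ∈ V i
  | and φ ψ, x => φ.Sat R V x ∧ ψ.Sat R V x
  | ex p φ, x => ∃ y, R p x y ∧ φ.Sat R V y

theorem sat_equiv {α β : Type*} (e : α ≃ β) (R : RoleName → β → β → Prop) (V : Fin 4 → Set α)
    (φ : PosExpr) (x : α) :
    φ.Sat (fun p x y => R p (e x) (e y)) V x ↔ φ.Sat R (fun i => e.symm ⁻¹' V i) (e x) := by
  induction φ generalizing x with
  | var i => simp [Sat]
  | and φ ψ h₁ h₂ => simp [Sat, h₁, h₂]
  | ex p φ h =>
    simp only [Sat, h]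
    exact ⟨fun ⟨y, hy⟩ => ⟨e y, hy⟩, fun ⟨y, hy⟩ => ⟨e.symm y, by simpa using hy⟩⟩

end PosExpr

/-- The role names of a graph as relations. -/
def DataGraph.rel (G : DataGraph) (p : RoleName) (a b : Individual) : Prop := Atom.role p a b ∈ G

theorem DataGraph.rel_left {G : DataGraph} {p : RoleName} {a b : Individual} (h : G.rel p a b) :
    a ∈ G.nodes := Or.inr (Or.inl ⟨p, b, h⟩)

theorem DataGraph.rel_right {G : DataGraph} {p : RoleName} {a b : Individual} (h : G.rel p a b) :
    b ∈ G.nodes := Or.inr (Or.inr ⟨p, a, h⟩)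

/-- The sets assigned to the shape names `0, …, 3`. -/
def ShapeAssignment.val (S : ShapeAssignment) (i : Fin 4) : Set Individual :=
  {a | ShapeLiteral.pos i a ∈ S.lits}

theorem mem_eval_toPos (G : DataGraph) (S : ShapeAssignment) (φ : PosExpr) (a : Individual) :
    a ∈ eval G S φ.toPos ↔ φ.Sat G.rel S.val a := by
  induction φ generalizing a with
  | var i => rfl
  | and φ ψ h₁ h₂ => exact and_congr (h₁ a) (h₂ a)
  | ex p φ h =>
    constructor
    · rintro ⟨-, b, hb, hφ⟩
      exact ⟨b, hb, (h b).1 hφ⟩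
    · rintro ⟨b, hb, hφ⟩
      exact ⟨DataGraph.rel_left hb, b, hb, (h b).2 hφ⟩

/-- The syntax negates only shape names, so complements are pushed inward by duality. Totality turns
negative literals into complements at the nodes. -/
theorem mem_eval_toNeg {G : DataGraph} {S : ShapeAssignment} (hS : S.Total G) (φ : PosExpr)
    {a : Individual} (ha : a ∈ G.nodes) :
    a ∈ eval G S φ.toNeg ↔ ¬ φ.Sat G.rel S.val a := by
  induction φ generalizing a with
  | var i => exact ⟨fun h h' => S.consistent _ _ ⟨h', h⟩, fun h => (hS i a ha).resolve_left h⟩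
  | and φ ψ h₁ h₂ =>
    exact (or_congr (h₁ ha) (h₂ ha)).trans not_and_or.symm
  | ex p φ h =>
    constructor
    · rintro ⟨-, hb⟩ ⟨b, hab, hφ⟩
      have hbn := DataGraph.rel_right hab
      exact (h hbn).1 (hb b hbn hab) hφ
    · exact fun hn => ⟨ha, fun b hb hab => (h hb).2 fun hφ => hn ⟨b, hab, hφ⟩⟩

/-! ### Rules and their failure, seen from one target node. -/

/-- A rule `φ → ψ`. -/
abbrev Rule := PosExpr × PosExpr

/-- The role that connects the target to the domain of interest. -/
def domRole : RoleName := 0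

/-- The rule is true at all points of the domain of `a`. -/
def Rule.Holds {α : Type*} (R : RoleName → α → α → Prop) (V : Fin 4 → Set α) (a : α)
    (r : Rule) : Prop :=
  ∀ x, R domRole a x → r.1.Sat R V x → r.2.Sat R V x

/-- All points of the domain of `a` lie in the shape `2`, but one of the rules fails, or the
conclusion `g` holds throughout. -/
def Failure {α : Type*} (R : RoleName → α → α → Prop) (V : Fin 4 → Set α) (rs : List Rule)
    (g : Rule) (a : α) : Prop :=
  (∀ x, R domRole a x → x ∈ V 2) ∧ ((∃ r ∈ rs, ¬ r.Holds R V a) ∨ g.Holds R V a)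

/-- The disjunction that expresses that one of the rules fails or `g` holds. -/
def failureDisj (rs : List Rule) (g : Rule) : ShapeExpr :=
  rs.foldr (fun r φ => .or (.ex (.name domRole) (.and r.1.toPos r.2.toNeg)) φ)
    (.all (.name domRole) (.or g.1.toNeg g.2.toPos))

/-- The shape expression for `Failure`. -/
def failureExpr (rs : List Rule) (g : Rule) : ShapeExpr :=
  .and (.all (.name domRole) (.shape 2)) (failureDisj rs g)

theorem mem_eval_failureDisj {G : DataGraph} {S : ShapeAssignment} (hS : S.Total G)
    (rs : List Rule) (g : Rule) {a : Individual} (ha : a ∈ G.nodes) :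
    a ∈ eval G S (failureDisj rs g) ↔
      (∃ r ∈ rs, ¬ r.Holds G.rel S.val a) ∨ g.Holds G.rel S.val a := by
  induction rs with
  | nil =>
    simp only [List.not_mem_nil, false_and, exists_false, false_or]
    constructor
    · rintro ⟨-, h⟩ x hx h₁
      have hxn := DataGraph.rel_right hx
      rcases h x hxn hx with h | h
      · exact absurd h₁ ((mem_eval_toNeg hS _ hxn).1 h)
      · exact (mem_eval_toPos ..).1 h
    · refine fun h => ⟨ha, fun b hb hab => ?_⟩
      by_cases h₁ : g.1.Sat G.rel S.val b
      · exact Or.inr ((mem_eval_toPos ..).2 (h b hab h₁))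
      · exact Or.inl ((mem_eval_toNeg hS _ hb).2 h₁)
  | cons r rs ih =>
    simp only [List.exists_mem_cons_iff, or_assoc]
    refine or_congr ?_ ih
    constructor
    · rintro ⟨-, b, hab, h₁, h₂⟩ h
      exact (mem_eval_toNeg hS _ (DataGraph.rel_right hab)).1 h₂
        (h b hab ((mem_eval_toPos ..).1 h₁))
    · intro h
      simp only [Rule.Holds, not_forall] at h
      obtain ⟨b, hab, h₁, h₂⟩ := h
      exact ⟨ha, b, hab, (mem_eval_toPos ..).2 h₁,
        (mem_eval_toNeg hS _ (DataGraph.rel_right hab)).2 h₂⟩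

theorem mem_eval_failureExpr {G : DataGraph} {S : ShapeAssignment} (hS : S.Total G)
    (rs : List Rule) (g : Rule) (a : Individual) :
    a ∈ eval G S (failureExpr rs g) ↔ a ∈ G.nodes ∧ Failure G.rel S.val rs g a := by
  constructor
  · rintro ⟨⟨ha, h⟩, h'⟩
    exact ⟨ha, fun x hx => h x (DataGraph.rel_right hx) hx, (mem_eval_failureDisj hS rs g ha).1 h'⟩
  · rintro ⟨ha, h, h'⟩
    exact ⟨⟨ha, fun x _ hx => h x hx⟩, (mem_eval_failureDisj hS rs g ha).2 h'⟩

/-! ### Second-order quantification by self-referential constraints. -/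

/-- The shapes `0`, `1`, `2` are arbitrary sets, the shape `3` is the concept name `1`, and the
shape `4` is given by `failureExpr`. -/
def failureConstraints (rs : List Rule) (g : Rule) : ConstraintSet :=
  [(0, .shape 0), (1, .shape 1), (2, .shape 2), (3, .concept 1), (4, failureExpr rs g)]

/-- The total shape assignment with the given extensions. -/
def ShapeAssignment.ofSets (V : ShapeName → Set Individual) : ShapeAssignment where
  lits := {l | match l with
    | .pos s a => a ∈ V s
    | .neg s a => a ∉ V s}
  consistent := fun _ _ h => h.2 h.1

theorem ShapeAssignment.total_ofSets (V : ShapeName → Set Individual) (G : DataGraph) :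
    (ofSets V).Total G := fun s a _ => em (a ∈ V s)

/-- The self-referential constraints are vacuous, so brave satisfaction guesses the valuation, and
shape 4 merely evaluates a formula under it. -/
theorem satisfies_failureConstraints_iff (G : DataGraph) (rs : List Rule) (g : Rule)
    {a : Individual} (ha : a ∈ G.nodes) :
    Satisfies G (nodeDoc (failureConstraints rs g) 4 a) ↔
      ∃ V : Fin 4 → Set Individual, V 3 = G.conceptExt 1 ∧ Failure G.rel V rs g a := by
  constructor
  · rintro ⟨S, ⟨hT, hS⟩, h, -, -⟩
    refine ⟨S.val, hS (3, .concept 1) (by simp [nodeDoc, failureConstraints]), ?_⟩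
    have h₄ := hS (4, failureExpr rs g) (by simp [nodeDoc, failureConstraints])
    have h₅ : a ∈ eval G S (.shape 4) := h a 4 (by simp [nodeDoc])
    rw [h₄] at h₅
    exact ((mem_eval_failureExpr hT rs g a).1 h₅).2
  · rintro ⟨V, hV, h⟩
    -- Shape names above 4 are unconstrained and get the same extension as 4.
    set S := ShapeAssignment.ofSets fun s =>
      if hs : s < 4 then V ⟨s, hs⟩ else {a | a ∈ G.nodes ∧ Failure G.rel V rs g a} with hS
    have hT : S.Total G := ShapeAssignment.total_ofSets _ G
    have hval : S.val = V := by
      funext i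
      ext x
      simp [hS, ShapeAssignment.val, ShapeAssignment.ofSets]
    have h₃ : eval G S (.shape 3) = V 3 := congrFun hval 3
    have h₄ : eval G S (.shape 4) = eval G S (failureExpr rs g) := by
      ext x
      rw [mem_eval_failureExpr hT, hval]
      simp [eval, hS, ShapeAssignment.ofSets]
    refine ⟨S, ⟨hT, ?_⟩, ?_, ?_, ?_⟩
    · simp only [nodeDoc, failureConstraints, List.forall_mem_cons]
      exact ⟨trivial, trivial, trivial, h₃.trans hV, h₄, by simp⟩
    · rintro b s hb
      obtain ⟨rfl, rfl⟩ : b = a ∧ s = 4 := by simpa [nodeDoc] using hb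
      have : b ∈ eval G S (.shape 4) := by
        rw [h₄, mem_eval_failureExpr hT, hval]
        exact ⟨ha, h⟩
      exact this
    · simp [nodeDoc]
    · simp [nodeDoc]

/-! ### Stratification. -/

theorem PosExpr.lt_of_negShape_mem_sub_toNeg (φ : PosExpr) {s : ShapeName}
    (h : ShapeExpr.negShape s ∈ φ.toNeg.sub) : s < 4 := by
  induction φ with
  | var i =>
    simp only [toNeg, ShapeExpr.sub, Set.mem_insert_iff, Set.mem_singleton_iff,
      ShapeExpr.negShape.injEq, reduceCtorEq, or_false] at h
    exact h ▸ i.isLt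
  | and φ ψ h₁ h₂ => simp [toNeg, ShapeExpr.sub] at h; tauto
  | ex p φ h₁ => simp [toNeg, ShapeExpr.sub] at h; tauto

theorem PosExpr.negShape_notMem_sub_toPos (φ : PosExpr) (s : ShapeName) :
    ShapeExpr.negShape s ∉ φ.toPos.sub := by
  induction φ with
  | var i => simp [toPos, ShapeExpr.sub]
  | and φ ψ h₁ h₂ => simp [toPos, ShapeExpr.sub, h₁, h₂]
  | ex p φ h₁ => simp [toPos, ShapeExpr.sub, h₁]

theorem lt_of_negShape_mem_sub_failureExpr {rs : List Rule} {g : Rule} {s : ShapeName}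
    (h : ShapeExpr.negShape s ∈ (failureExpr rs g).sub) : s < 4 := by
  have h : ShapeExpr.negShape s ∈ (failureDisj rs g).sub := by
    simpa [failureExpr, ShapeExpr.sub] using h
  induction rs with
  | nil =>
    exact g.1.lt_of_negShape_mem_sub_toNeg
      (by simpa [failureDisj, ShapeExpr.sub, PosExpr.negShape_notMem_sub_toPos] using h)
  | cons r rs ih =>
    have h : ShapeExpr.negShape s ∈ r.2.toNeg.sub ∨
        ShapeExpr.negShape s ∈ (failureDisj rs g).sub := by
      simpa [failureDisj, ShapeExpr.sub, PosExpr.negShape_notMem_sub_toPos] using h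
    refine h.elim r.2.lt_of_negShape_mem_sub_toNeg fun h => ih ?_ h
    simpa [failureExpr, ShapeExpr.sub] using h

/-- Shape 4 alone forms the upper stratum. Only shapes below 4 are negated, and the self-references
are positive. -/
theorem stratified_failureConstraints (rs : List Rule) (g : Rule) :
    (failureConstraints rs g).Stratified := by
  refine ⟨1, fun c => if c.1 = 4 then 1 else 0, fun c _ => by dsimp only; split_ifs <;> simp, ?_⟩
  simp only [failureConstraints, List.forall_mem_cons]
  refine ⟨?_, ?_, ?_, ?_, ?_, by simp⟩
  iterate 4 simp [ShapeExpr.sub]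
  refine ⟨by simp, fun s hs => ?_⟩
  have := lt_of_negShape_mem_sub_failureExpr hs
  interval_cases s <;> simp

theorem uniqueHeads_failureConstraints (rs : List Rule) (g : Rule) :
    (failureConstraints rs g).UniqueHeads := by
  simp [ConstraintSet.UniqueHeads, failureConstraints]

/-! ### Description of computations by rules. -/

open Turing.ToPartrec (Code)

/-- An injective numbering of the codes. -/
def codeIndex : Code → ℕ
  | .zero' => 0
  | .succ => 1
  | .tail => 2
  | .cons f g => 4 * Nat.pair (codeIndex f) (codeIndex g) + 3
  | .comp f g => 4 * Nat.pair (codeIndex f) (codeIndex g) + 4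
  | .case f g => 4 * Nat.pair (codeIndex f) (codeIndex g) + 5
  | .fix f => 4 * codeIndex f + 6

theorem codeIndex_injective : Function.Injective codeIndex := by
  intro c d h
  induction c generalizing d with
  | zero' | succ | tail => cases d <;> simp only [codeIndex] at h <;> first | rfl | omega
  | cons f g hf hg | comp f g hf hg | case f g hf hg =>
    cases d <;> simp only [codeIndex] at h <;> try omega
    rename_i f' g'
    have h := Nat.pair_eq_pair.1 (by omega :
      Nat.pair (codeIndex f) (codeIndex g) = Nat.pair (codeIndex f') (codeIndex g'))
    rw [hf h.1, hg h.2]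
  | fix f hf =>
    cases d <;> simp only [codeIndex] at h <;> try omega
    rename_i f'
    rw [hf (by omega : codeIndex f = codeIndex f')]

/-- The role from a list to its head. -/
def headRole : RoleName := 1

/-- The role from a list to its tail. -/
def tailRole : RoleName := 2

/-- The role from a number to its predecessor. -/
def predRole : RoleName := 3

/-- The role from a list `k + 1 :: t` to the list `k :: t`. -/
def decRole : RoleName := 4

/-- The role from the inputs to the outputs of a code. -/
def codeRole (c : Code) : RoleName := codeIndex c + 5

section Rules

open PosExpr

/-- The points of the domain that stand for `0` and for the empty list. -/
def nilExpr : PosExpr := and (var 3) (var 2)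

/-- The points with a head in `φ` and a tail in `ψ`. -/
def consExpr (φ ψ : PosExpr) : PosExpr := and (ex headRole φ) (ex tailRole ψ)

/-- Rules for the role names other than those of the codes. -/
def dataRules : List Rule :=
  -- The empty list has head 0 and tail empty, matching the default values of `headI` and `tail`.
  [(var 3, ex headRole nilExpr), (var 3, ex tailRole nilExpr),
    (consExpr (ex predRole (var 0)) (var 1), ex decRole (and (var 2) (consExpr (var 0) (var 1))))]

/-- Rules for the role names of the subcodes of a code. -/
def codeRules : Code → List Rule
  | .zero' => [(var 0, ex (codeRole .zero') (and (var 2) (consExpr nilExpr (var 0))))]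
  | .succ => [(ex headRole (var 0),
      ex (codeRole .succ) (and (var 2) (consExpr (and (var 2) (ex predRole (var 0))) nilExpr)))]
  | .tail => [(ex tailRole (var 0), ex (codeRole .tail) (var 0))]
  | .cons f g =>
    (and (ex (codeRole f) (ex headRole (var 0))) (ex (codeRole g) (var 1)),
      ex (codeRole (.cons f g)) (and (var 2) (consExpr (var 0) (var 1)))) ::
    (codeRules f ++ codeRules g)
  | .comp f g =>
    (ex (codeRole g) (ex (codeRole f) (var 0)), ex (codeRole (.comp f g)) (var 0)) ::
    (codeRules f ++ codeRules g)
  | .case f g =>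
    (consExpr (var 3) (ex (codeRole f) (var 0)), ex (codeRole (.case f g)) (var 0)) ::
    (ex decRole (ex (codeRole g) (var 0)), ex (codeRole (.case f g)) (var 0)) ::
    (codeRules f ++ codeRules g)
  | .fix f =>
    (ex (codeRole f) (consExpr (var 3) (var 0)), ex (codeRole (.fix f)) (var 0)) ::
    -- A nonzero head is recognised by a predecessor in the domain. The role of `fix f` on the left
    -- expresses the recursion.
    (ex (codeRole f) (consExpr (ex predRole (var 2)) (ex (codeRole (.fix f)) (var 0))),
      ex (codeRole (.fix f)) (var 0)) ::
    codeRules f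

/-- The points that stand for the number `n`. -/
def numExpr : ℕ → PosExpr
  | 0 => nilExpr
  | n + 1 => and (var 2) (ex predRole (numExpr n))

/-- If all points that stand for `[n]` have an output under `c`, then this rule holds. -/
def haltRule (c : Code) (n : ℕ) : Rule :=
  (consExpr (numExpr n) nilExpr, ex (codeRole c) (var 2))

end Rules

/-! ### Halting forces a failure in every graph. -/

section Representation

variable {α : Type*} (R : RoleName → α → α → Prop) (N : Set α) (a : α)

/-- The point `x` of the domain of `a` stands for the number `n`. -/
def RepNat : ℕ → α → Prop
  | 0, x => R domRole a x ∧ x ∈ N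
  | n + 1, x => R domRole a x ∧ ∃ y, R predRole x y ∧ RepNat n y

/-- The point `x` of the domain of `a` stands for the list `l`. -/
def RepList : List ℕ → α → Prop
  | [], x => R domRole a x ∧ x ∈ N
  | n :: l, x => R domRole a x ∧
      (∃ y, R headRole x y ∧ RepNat R N a n y) ∧ ∃ y, R tailRole x y ∧ RepList l y

/-- The rules hold for all valuations that interpret the shape `3` by `N` and the shape `2` by a
set that contains the domain of `a`. -/
def Valid (rs : List Rule) : Prop :=
  ∀ V : Fin 4 → Set α, V 3 = N → (∀ x, R domRole a x → x ∈ V 2) → ∀ r ∈ rs, r.Holds R V a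

variable {R N a}

theorem RepNat.dom {n : ℕ} {x : α} (h : RepNat R N a n x) : R domRole a x := by
  cases n <;> exact h.1

theorem RepList.dom {l : List ℕ} {x : α} (h : RepList R N a l x) : R domRole a x := by
  cases l <;> exact h.1

theorem Valid.mono {rs rs' : List Rule} (h : Valid R N a rs) (hs : rs' ⊆ rs) : Valid R N a rs' :=
  fun V hV hW r hr => h V hV hW r (hs hr)

/-- A valid rule, for the valuation by two sets and the domain of `a`. -/
theorem Valid.apply {rs : List Rule} (h : Valid R N a rs) {r : Rule} (hr : r ∈ rs) (X Y : Set α)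
    {x : α} (hx : R domRole a x) (h₁ : r.1.Sat R ![X, Y, {y | R domRole a y}, N] x) :
    r.2.Sat R ![X, Y, {y | R domRole a y}, N] x :=
  h _ rfl (fun _ h => h) r hr x hx h₁

theorem RepList.head {l : List ℕ} {x : α} (hd : Valid R N a dataRules) (h : RepList R N a l x) :
    ∃ y, R headRole x y ∧ RepNat R N a l.headI y := by
  cases l with
  | nil =>
    obtain ⟨y, hy, h₁, h₂⟩ := hd.apply (r := dataRules[0]) (by simp) ∅ ∅ h.1 h.2
    exact ⟨y, hy, h₂, h₁⟩
  | cons n l => exact h.2.1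

theorem RepList.tail {l : List ℕ} {x : α} (hd : Valid R N a dataRules) (h : RepList R N a l x) :
    ∃ y, R tailRole x y ∧ RepList R N a l.tail y := by
  cases l with
  | nil =>
    obtain ⟨y, hy, h₁, h₂⟩ := hd.apply (r := dataRules[1]) (by simp) ∅ ∅ h.1 h.2
    exact ⟨y, hy, h₂, h₁⟩
  | cons n l => exact h.2.2

theorem RepList.dec {n : ℕ} {l : List ℕ} {x : α} (hd : Valid R N a dataRules)
    (h : RepList R N a ((n + 1) :: l) x) : ∃ y, R decRole x y ∧ RepList R N a (n :: l) y := by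
  obtain ⟨hx, ⟨y, hy, -, z, hz, hn⟩, t, ht, hl⟩ := h
  -- The singletons `{z}` and `{t}` force the new point to have exactly the predecessor `z` as a
  -- head and `t` as a tail.
  obtain ⟨u, hu, hW, ⟨p, hp, rfl⟩, q, hq, rfl⟩ := hd.apply (r := dataRules[2]) (by simp) {z} {t} hx
    ⟨⟨y, hy, z, hz, rfl⟩, t, ht, rfl⟩
  exact ⟨u, hu, hW, ⟨p, hp, hn⟩, q, hq, hl⟩

/-- In every structure in which the rules are valid, the computations of `c` are present. -/
theorem exists_repList_of_mem_eval (hd : Valid R N a dataRules) (c : Code)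
    (hc : Valid R N a (codeRules c)) {v w : List ℕ} (hw : w ∈ c.eval v) {x : α}
    (hx : RepList R N a v x) : ∃ y, R (codeRole c) x y ∧ RepList R N a w y := by
  induction c generalizing v w x with
  | zero' =>
    obtain rfl : w = 0 :: v := by simpa using hw
    -- With shape 0 equal to `{x}`, the tail of the new point is `x` itself.
    obtain ⟨y, hy, hW, ⟨p, hp, hp₁, hp₂⟩, q, hq, rfl⟩ :=
      hc.apply (List.mem_singleton_self _) {x} ∅ hx.dom rfl
    exact ⟨y, hy, hW, ⟨p, hp, hp₂, hp₁⟩, q, hq, hx⟩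
  | succ =>
    obtain rfl : w = [v.headI.succ] := by simpa using hw
    obtain ⟨z, hz, hn⟩ := hx.head hd
    obtain ⟨y, hy, hW, ⟨p, hp, hpW, r, hr, rfl⟩, q, hq, hq₁, hq₂⟩ :=
      hc.apply (List.mem_singleton_self _) {z} ∅ hx.dom ⟨z, hz, rfl⟩
    exact ⟨y, hy, hW, ⟨p, hp, hpW, r, hr, hn⟩, q, hq, hq₂, hq₁⟩
  | tail =>
    obtain rfl : w = v.tail := by simpa using hw
    obtain ⟨z, hz, hl⟩ := hx.tail hd
    obtain ⟨y, hy, rfl⟩ := hc.apply (List.mem_singleton_self _) {z} ∅ hx.dom ⟨z, hz, rfl⟩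
    exact ⟨y, hy, hl⟩
  | cons f g hf hg =>
    obtain ⟨u, hu, s, hs, rfl⟩ : ∃ u ∈ f.eval v, ∃ s ∈ g.eval v, w = u.headI :: s := by
      simpa using hw
    obtain ⟨y, hy, hy'⟩ := hf (hc.mono fun r hr => by simp [codeRules, hr]) hu hx
    obtain ⟨z, hz, hn⟩ := hy'.head hd
    obtain ⟨t, ht, ht'⟩ := hg (hc.mono fun r hr => by simp [codeRules, hr]) hs hx
    obtain ⟨e, he, hW, ⟨p, hp, rfl⟩, q, hq, rfl⟩ :=
      hc.apply List.mem_cons_self {z} {t} hx.dom ⟨⟨y, hy, z, hz, rfl⟩, t, ht, rfl⟩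
    exact ⟨e, he, hW, ⟨p, hp, hn⟩, q, hq, ht'⟩
  | comp f g hf hg =>
    obtain ⟨u, hu, hw⟩ : ∃ u ∈ g.eval v, w ∈ f.eval u := by
      rw [Code.comp_eval] at hw
      exact Part.mem_bind_iff.1 hw
    obtain ⟨y, hy, hy'⟩ := hg (hc.mono fun r hr => by simp [codeRules, hr]) hu hx
    obtain ⟨z, hz, hz'⟩ := hf (hc.mono fun r hr => by simp [codeRules, hr]) hw hy'
    obtain ⟨e, he, rfl⟩ := hc.apply List.mem_cons_self {z} ∅ hx.dom ⟨y, hy, z, hz, rfl⟩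
    exact ⟨e, he, hz'⟩
  | case f g hf hg =>
    rw [Code.case_eval] at hw
    rcases hn : v.headI with _ | n
    · simp only [hn] at hw
      obtain ⟨p, hp, hp'⟩ := hx.head hd
      rw [hn] at hp'
      obtain ⟨t, ht, ht'⟩ := hx.tail hd
      obtain ⟨z, hz, hz'⟩ := hf (hc.mono fun r hr => by simp [codeRules, hr]) hw ht'
      obtain ⟨e, he, rfl⟩ := hc.apply List.mem_cons_self {z} ∅ hx.dom
        ⟨⟨p, hp, hp'.2⟩, t, ht, z, hz, rfl⟩
      exact ⟨e, he, hz'⟩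
    · simp only [hn] at hw
      obtain ⟨l, rfl⟩ : ∃ l, v = (n + 1) :: l := by
        cases v with
        | nil => cases hn
        | cons m l => exact ⟨l, by rw [← hn]; rfl⟩
      obtain ⟨y, hy, hy'⟩ := hx.dec hd
      obtain ⟨z, hz, hz'⟩ := hg (hc.mono fun r hr => by simp [codeRules, hr]) hw hy'
      obtain ⟨e, he, rfl⟩ := hc.apply (List.mem_cons_of_mem _ List.mem_cons_self) {z} ∅ hx.dom
        ⟨y, hy, z, hz, rfl⟩
      exact ⟨e, he, hz'⟩
  | fix f hf =>
    rw [Code.fix_eval] at hw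
    -- The point is generalized because each iteration restarts at the tail of the previous output.
    refine PFun.fixInduction' (C := fun v => ∀ x, RepList R N a v x →
      ∃ y, R (codeRole (.fix f)) x y ∧ RepList R N a w y) hw ?_ ?_ x hx
    · intro v hv x hx
      obtain ⟨u, hu, hu'⟩ := (Part.mem_map_iff _).1 hv
      split_ifs at hu' with h₀
      obtain rfl := Sum.inl.inj hu'
      obtain ⟨y, hy, hy'⟩ := hf (hc.mono fun r hr => by simp [codeRules, hr]) hu hx
      obtain ⟨p, hp, hp'⟩ := hy'.head hd
      rw [h₀] at hp'
      obtain ⟨t, ht, ht'⟩ := hy'.tail hd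
      obtain ⟨e, he, rfl⟩ := hc.apply List.mem_cons_self {t} ∅ hx.dom
        ⟨y, hy, ⟨p, hp, hp'.2⟩, t, ht, rfl⟩
      exact ⟨e, he, ht'⟩
    · intro v v' hw hv ih x hx
      obtain ⟨u, hu, hu'⟩ := (Part.mem_map_iff _).1 hv
      split_ifs at hu' with h₀
      obtain rfl := Sum.inr.inj hu'
      obtain ⟨n, hn⟩ := Nat.exists_eq_succ_of_ne_zero h₀
      obtain ⟨y, hy, hy'⟩ := hf (hc.mono fun r hr => by simp [codeRules, hr]) hu hx
      obtain ⟨p, hp, hp'⟩ := hy'.head hd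
      rw [hn] at hp'
      obtain ⟨-, q, hq, hq'⟩ := hp'
      obtain ⟨t, ht, ht'⟩ := hy'.tail hd
      obtain ⟨z, hz, hz'⟩ := ih t ht'
      obtain ⟨e, he, rfl⟩ := hc.apply (List.mem_cons_of_mem _ List.mem_cons_self) {z} ∅ hx.dom
        ⟨y, hy, ⟨p, hp, q, hq, hq'.dom⟩, t, ht, z, hz, rfl⟩
      exact ⟨e, he, hz'⟩

theorem repNat_of_sat_numExpr {V : Fin 4 → Set α} (h₃ : V 3 = N) (h₂ : V 2 = {x | R domRole a x})
    {n : ℕ} {x : α} (h : (numExpr n).Sat R V x) : RepNat R N a n x := by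
  induction n generalizing x with
  | zero => exact ⟨(h₂ ▸ h.2 : x ∈ {x | R domRole a x}), h₃ ▸ h.1⟩
  | succ n ih =>
    obtain ⟨hx, y, hy, h⟩ := h
    exact ⟨(h₂ ▸ hx : x ∈ {x | R domRole a x}), y, hy, ih h⟩

/-- If `c` halts on `[n]`, then every structure has a valuation that exhibits a failure. -/
theorem exists_failure_of_dom (R : RoleName → α → α → Prop) (N : Set α) (a : α) {c : Code} {n : ℕ}
    (hc : (c.eval [n]).Dom) :
    ∃ V : Fin 4 → Set α, V 3 = N ∧ Failure R V (dataRules ++ codeRules c) (haltRule c n) a := by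
  by_contra! hV
  have hvalid : Valid R N a (dataRules ++ codeRules c) := fun V h₃ h₂ r hr => by
    by_contra h
    exact hV V h₃ ⟨h₂, Or.inl ⟨r, hr, h⟩⟩
  -- Shapes 0 and 1 do not occur in `haltRule`.
  refine hV ![∅, ∅, {x | R domRole a x}, N] rfl ⟨fun x hx => hx, Or.inr fun x hx h => ?_⟩
  obtain ⟨⟨p, hp, hp'⟩, q, hq, hq₁, hq₂⟩ := h
  obtain ⟨y, hy, hy'⟩ := exists_repList_of_mem_eval (hvalid.mono (by simp)) c
    (hvalid.mono (by simp)) (Part.get_mem hc)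
    (x := x) ⟨hx, ⟨p, hp, repNat_of_sat_numExpr rfl rfl hp'⟩, q, hq, hq₂, hq₁⟩
  exact ⟨y, hy, hy'.dom⟩

end Representation

/-! ### The counterexample for a computation that does not halt. -/

section ListModel

/-- The intended interpretation of the role names by relations between lists, where the number `n`
is represented by a list of `n` zeros and the target by the empty list. -/
def listRel (p : RoleName) (v w : List ℕ) : Prop :=
  p = domRole ∧ v = [] ∨ p = headRole ∧ w = List.replicate v.headI 0 ∨
  p = tailRole ∧ w = v.tail ∨ p = predRole ∧ v = 0 :: w ∨
  p = decRole ∧ (∃ k t, v = (k + 1) :: t ∧ w = k :: t) ∨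
  ∃ c, p = codeRole c ∧ w ∈ c.eval v

variable {v w : List ℕ}

theorem listRel_domRole : listRel domRole v w ↔ v = [] := by
  simp [listRel, domRole, headRole, tailRole, predRole, decRole, codeRole]

theorem listRel_headRole : listRel headRole v w ↔ w = List.replicate v.headI 0 := by
  simp [listRel, domRole, headRole, tailRole, predRole, decRole, codeRole]

theorem listRel_tailRole : listRel tailRole v w ↔ w = v.tail := by
  simp [listRel, domRole, headRole, tailRole, predRole, decRole, codeRole]

theorem listRel_predRole : listRel predRole v w ↔ v = 0 :: w := by
  simp [listRel, domRole, headRole, tailRole, predRole, decRole, codeRole]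

theorem listRel_decRole : listRel decRole v w ↔ ∃ k t, v = (k + 1) :: t ∧ w = k :: t := by
  simp [listRel, domRole, headRole, tailRole, predRole, decRole, codeRole]

theorem listRel_codeRole {c : Code} : listRel (codeRole c) v w ↔ w ∈ c.eval v := by
  simp [listRel, domRole, headRole, tailRole, predRole, decRole, codeRole,
    codeIndex_injective.eq_iff]

variable {V : Fin 4 → Set (List ℕ)} {φ ψ : PosExpr}

theorem sat_listRel_var_two (h₂ : V 2 = Set.univ) : (PosExpr.var 2).Sat listRel V v := by
  simp [PosExpr.Sat, h₂]

theorem sat_listRel_nilExpr (h₃ : V 3 = {[]}) (h₂ : V 2 = Set.univ) :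
    nilExpr.Sat listRel V v ↔ v = [] := by
  simp [nilExpr, PosExpr.Sat, h₃, h₂]

theorem sat_listRel_consExpr : (consExpr φ ψ).Sat listRel V v ↔
    φ.Sat listRel V (List.replicate v.headI 0) ∧ ψ.Sat listRel V v.tail := by
  simp [consExpr, PosExpr.Sat, listRel_headRole, listRel_tailRole]

theorem sat_listRel_ex_codeRole {c : Code} : (PosExpr.ex (codeRole c) φ).Sat listRel V v ↔
    ∃ w ∈ c.eval v, φ.Sat listRel V w := by
  simp [PosExpr.Sat, listRel_codeRole]

theorem sat_listRel_ex_predRole_replicate {n : ℕ} :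
    (PosExpr.ex predRole φ).Sat listRel V (List.replicate n 0) ↔
      ∃ m, n = m + 1 ∧ φ.Sat listRel V (List.replicate m 0) := by
  cases n <;> simp [PosExpr.Sat, listRel_predRole, List.replicate_succ]

theorem holds_dataRules_listRel (h₃ : V 3 = {[]}) (h₂ : V 2 = Set.univ) :
    ∀ r ∈ dataRules, r.Holds listRel V [] := by
  simp only [dataRules, List.forall_mem_cons]
  refine ⟨?_, ?_, ?_, by simp⟩ <;> intro x _ h
  · obtain rfl : x = [] := by simpa [PosExpr.Sat, h₃] using h
    exact ⟨[], listRel_headRole.2 rfl, (sat_listRel_nilExpr h₃ h₂).2 rfl⟩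
  · obtain rfl : x = [] := by simpa [PosExpr.Sat, h₃] using h
    exact ⟨[], listRel_tailRole.2 rfl, (sat_listRel_nilExpr h₃ h₂).2 rfl⟩
  · obtain ⟨hp, ht⟩ := sat_listRel_consExpr.1 h
    obtain ⟨m, hm, hm'⟩ := sat_listRel_ex_predRole_replicate.1 hp
    obtain ⟨l, rfl⟩ : ∃ l, x = (m + 1) :: l := by
      cases x with
      | nil => cases hm
      | cons k l => exact ⟨l, by rw [← hm]; rfl⟩
    exact ⟨m :: l, listRel_decRole.2 ⟨m, l, rfl, rfl⟩, sat_listRel_var_two h₂,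
      sat_listRel_consExpr.2 ⟨hm', ht⟩⟩

/-- Each rule mirrors a clause of the evaluation of codes: shapes 0 and 1 are transported unchanged
from premise to conclusion, so the valuation of these shapes is immaterial. -/
theorem holds_codeRules_listRel (h₃ : V 3 = {[]}) (h₂ : V 2 = Set.univ) (c : Code) :
    ∀ r ∈ codeRules c, r.Holds listRel V [] := by
  have hnil : ∀ v, nilExpr.Sat listRel V v ↔ v = [] := fun v => sat_listRel_nilExpr h₃ h₂
  have hvar₂ : ∀ v, (PosExpr.var 2).Sat listRel V v := fun v => sat_listRel_var_two h₂
  have hvar₃ : ∀ v, (PosExpr.var 3).Sat listRel V v ↔ v = [] := fun v => by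
    simp [PosExpr.Sat, h₃]
  induction c with
  | zero' =>
    simp only [codeRules, List.forall_mem_singleton]
    exact fun x _ h => sat_listRel_ex_codeRole.2 ⟨0 :: x, by simp, hvar₂ _,
      sat_listRel_consExpr.2 ⟨(hnil _).2 rfl, h⟩⟩
  | succ =>
    simp only [codeRules, List.forall_mem_singleton]
    rintro x - ⟨y, hy, h⟩
    rw [listRel_headRole] at hy
    subst hy
    exact sat_listRel_ex_codeRole.2 ⟨[x.headI.succ], by simp, hvar₂ _,
      sat_listRel_consExpr.2 ⟨⟨hvar₂ _, sat_listRel_ex_predRole_replicate.2 ⟨_, rfl, h⟩⟩,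
        (hnil _).2 rfl⟩⟩
  | tail =>
    simp only [codeRules, List.forall_mem_singleton]
    rintro x - ⟨y, hy, h⟩
    rw [listRel_tailRole] at hy
    subst hy
    exact sat_listRel_ex_codeRole.2 ⟨x.tail, by simp, h⟩
  | cons f g hf hg =>
    simp only [codeRules, List.forall_mem_cons, List.forall_mem_append]
    refine ⟨?_, hf, hg⟩
    rintro x - ⟨h₁, h₄⟩
    obtain ⟨u, hu, y, hy, h₁⟩ := sat_listRel_ex_codeRole.1 h₁
    obtain ⟨s, hs, h₄⟩ := sat_listRel_ex_codeRole.1 h₄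
    rw [listRel_headRole] at hy
    subst hy
    refine sat_listRel_ex_codeRole.2 ⟨u.headI :: s, ?_, hvar₂ _, sat_listRel_consExpr.2 ⟨h₁, h₄⟩⟩
    rw [Code.cons_eval]
    exact Part.mem_bind_iff.2 ⟨u, hu, Part.mem_bind_iff.2 ⟨s, hs, Part.mem_some _⟩⟩
  | comp f g hf hg =>
    simp only [codeRules, List.forall_mem_cons, List.forall_mem_append]
    refine ⟨?_, hf, hg⟩
    intro x _ h
    obtain ⟨u, hu, h⟩ := sat_listRel_ex_codeRole.1 h
    obtain ⟨s, hs, h⟩ := sat_listRel_ex_codeRole.1 h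
    refine sat_listRel_ex_codeRole.2 ⟨s, ?_, h⟩
    rw [Code.comp_eval]
    exact Part.mem_bind_iff.2 ⟨u, hu, hs⟩
  | case f g hf hg =>
    simp only [codeRules, List.forall_mem_cons, List.forall_mem_append]
    refine ⟨?_, ?_, hf, hg⟩
    · intro x _ h
      obtain ⟨h₁, h⟩ := sat_listRel_consExpr.1 h
      obtain ⟨s, hs, h⟩ := sat_listRel_ex_codeRole.1 h
      have hx : x.headI = 0 := by simpa using (hvar₃ _).1 h₁
      exact sat_listRel_ex_codeRole.2 ⟨s, by simpa [Code.case_eval, hx] using hs, h⟩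
    · rintro x - ⟨y, hy, h⟩
      obtain ⟨k, t, rfl, rfl⟩ := listRel_decRole.1 hy
      obtain ⟨s, hs, h⟩ := sat_listRel_ex_codeRole.1 h
      exact sat_listRel_ex_codeRole.2 ⟨s, by simpa [Code.case_eval] using hs, h⟩
  | fix f hf =>
    simp only [codeRules, List.forall_mem_cons]
    refine ⟨?_, ?_, hf⟩
    · intro x _ h
      obtain ⟨u, hu, h⟩ := sat_listRel_ex_codeRole.1 h
      obtain ⟨h₁, h⟩ := sat_listRel_consExpr.1 h
      have hx : u.headI = 0 := by simpa using (hvar₃ _).1 h₁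
      refine sat_listRel_ex_codeRole.2 ⟨u.tail, ?_, h⟩
      rw [Code.fix_eval]
      exact PFun.mem_fix_iff.2 <| Or.inl ((Part.mem_map_iff _).2 ⟨u, hu, if_pos hx⟩)
    · intro x _ h
      obtain ⟨u, hu, h⟩ := sat_listRel_ex_codeRole.1 h
      obtain ⟨h₁, h⟩ := sat_listRel_consExpr.1 h
      obtain ⟨m, hm, -⟩ := sat_listRel_ex_predRole_replicate.1 h₁
      obtain ⟨w, hw, h⟩ := sat_listRel_ex_codeRole.1 h
      refine sat_listRel_ex_codeRole.2 ⟨w, ?_, h⟩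
      rw [Code.fix_eval] at hw ⊢
      exact PFun.mem_fix_iff.2 <| Or.inr ⟨u.tail, (Part.mem_map_iff _).2 ⟨u, hu, if_neg (by omega)⟩, hw⟩

theorem sat_listRel_numExpr (h₃ : V 3 = {[]}) (h₂ : V 2 = Set.univ) (n : ℕ) :
    (numExpr n).Sat listRel V (List.replicate n 0) := by
  induction n with
  | zero => exact (sat_listRel_nilExpr h₃ h₂).2 rfl
  | succ n ih =>
    exact ⟨sat_listRel_var_two h₂, sat_listRel_ex_predRole_replicate.2 ⟨n, rfl, ih⟩⟩

/-- If `c` does not halt on `[n]`, then the structure of lists satisfies all rules, and `haltRule`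
does not hold there. -/
theorem not_failure_listRel (h₃ : V 3 = {[]}) {c : Code} {n : ℕ} (hc : ¬ (c.eval [n]).Dom) :
    ¬ Failure listRel V (dataRules ++ codeRules c) (haltRule c n) [] := by
  rintro ⟨h, h'⟩
  -- The target sees every list, so shape 2 is completely determined.
  have h₂ : V 2 = Set.univ := Set.eq_univ_of_forall fun x => h x (listRel_domRole.2 rfl)
  rcases h' with ⟨r, hr, h'⟩ | h'
  · rcases List.mem_append.1 hr with hr | hr
    · exact h' (holds_dataRules_listRel h₃ h₂ r hr)
    · exact h' (holds_codeRules_listRel h₃ h₂ c r hr)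
  · obtain ⟨w, hw, -⟩ := sat_listRel_ex_codeRole.1 (h' [n] (listRel_domRole.2 rfl)
      (sat_listRel_consExpr.2 ⟨sat_listRel_numExpr h₃ h₂ n, (sat_listRel_nilExpr h₃ h₂).2 rfl⟩))
    exact hc (Part.dom_iff_mem.2 ⟨w, hw⟩)

end ListModel

/-! ### The reduction from halting. -/

/-- The numbering of lists by individuals. -/
def listEquiv : Individual ≃ List ℕ := (Denumerable.eqv (List ℕ)).symm

/-- The data graph of the structure of lists. -/
def listGraph : DataGraph :=
  {t | match t with
    | .concept A i => A = 1 ∧ listEquiv i = []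
    | .role p i j => listRel p (listEquiv i) (listEquiv j)}

theorem mem_nodes_listGraph (i : Individual) : i ∈ listGraph.nodes :=
  Or.inr (Or.inr ⟨domRole, listEquiv.symm [], by simp [listGraph, listRel_domRole]⟩)

/-- The input of the implication problem for the computation of `c` on `[n]`. -/
def haltInput (c : Code) (n : ℕ) : ImplicationInput :=
  (([], 0), (failureConstraints (dataRules ++ codeRules c) (haltRule c n), 4))

theorem satisfies_nil {G : DataGraph} (s : ShapeName) (a : Individual) :
    Satisfies G (nodeDoc [] s a) :=
  ⟨.ofSets fun _ => Set.univ, ⟨ShapeAssignment.total_ofSets _ G, by simp [nodeDoc]⟩,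
    fun b _ _ => Set.mem_univ b, by simp [nodeDoc], by simp [nodeDoc]⟩

/-- The premise of the implication is always satisfied, so everything rests on the existence of
failures: `listGraph` refutes it without halting, and halting yields a failure at every node. -/
theorem implies_haltInput_iff (c : Code) (n : ℕ) :
    (haltInput c n).Implies ↔ (c.eval [n]).Dom := by
  constructor
  · intro h
    by_contra hc
    have ha := mem_nodes_listGraph (listEquiv.symm [])
    have h := h listGraph (listEquiv.symm []) ha (fun i _ => mem_nodes_listGraph i)
      (fun i _ => mem_nodes_listGraph i) (satisfies_nil _ _)
    obtain ⟨V, hV, hF⟩ := (satisfies_failureConstraints_iff _ _ _ ha).1 h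
    refine not_failure_listRel (V := fun i => listEquiv.symm ⁻¹' V i) ?_ hc ?_
    · ext v
      simp [hV, DataGraph.conceptExt, listGraph, topConcept]
    · have hsat := PosExpr.sat_equiv listEquiv listRel V
      change Failure (fun p x y => listRel p (listEquiv x) (listEquiv y)) V _ _ _ at hF
      simpa [Failure, Rule.Holds, hsat, listEquiv.forall_congr_left] using hF
  · exact fun hc G a ha _ _ _ => (satisfies_failureConstraints_iff _ _ _ ha).2
      (exists_failure_of_dom G.rel (G.conceptExt 1) a hc)

theorem wellFormed_haltInput (c : Code) (n : ℕ) : (haltInput c n).WellFormed :=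
  ⟨List.nodup_nil, uniqueHeads_failureConstraints _ _⟩

theorem stratified_haltInput (c : Code) (n : ℕ) : (haltInput c n).Stratified :=
  ⟨⟨0, fun _ => 0, by simp, by simp [haltInput]⟩, stratified_failureConstraints _ _⟩

/-! ### Computability of the reduction. -/

section Computability

open Primrec

/-- Encodings of shape expressions are their arithmetic codes, so the constructor is a polynomial in
a Cantor pairing. -/
theorem ShapeExpr.primrec_and : Primrec₂ ShapeExpr.and :=
  Primrec.encode_iff.1 (nat_add.comp (nat_mul.comp (const 8)
    (Primrec₂.natPair.comp (Primrec.encode.comp fst) (Primrec.encode.comp snd))) (const 4))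

theorem ShapeExpr.primrec_or : Primrec₂ ShapeExpr.or :=
  Primrec.encode_iff.1 (nat_add.comp (nat_mul.comp (const 8)
    (Primrec₂.natPair.comp (Primrec.encode.comp fst) (Primrec.encode.comp snd))) (const 5))

theorem ShapeExpr.primrec_all (r : Role) : Primrec (ShapeExpr.all r) :=
  Primrec.encode_iff.1 (nat_add.comp (nat_mul.comp (const 8)
    (Primrec₂.natPair.comp (const r.code) Primrec.encode)) (const 6))

theorem primrec_toNeg_numExpr : Primrec fun n => (numExpr n).toNeg := by
  have h : Primrec₂ fun (_ : ℕ) φ => (ShapeExpr.negShape 2).or (.all (.name predRole) φ) :=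
    ShapeExpr.primrec_or.comp (const _) ((ShapeExpr.primrec_all _).comp snd)
  refine (nat_rec₁ nilExpr.toNeg h).of_eq fun n => ?_
  induction n with
  | zero => rfl
  | succ n ih => exact congrArg (fun φ => (ShapeExpr.negShape 2).or (.all (.name predRole) φ)) ih

/-- The rules contribute constants; `n` enters only through the negated numeral in the innermost
disjunct. -/
theorem primrec_failureDisj_haltRule (rs : List Rule) (c : Code) :
    Primrec fun n => failureDisj rs (haltRule c n) := by
  induction rs with
  | nil =>
    exact (ShapeExpr.primrec_all _).comp (ShapeExpr.primrec_or.comp (ShapeExpr.primrec_or.comp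
      ((ShapeExpr.primrec_all _).comp primrec_toNeg_numExpr) (const _)) (const _))
  | cons r rs ih => exact ShapeExpr.primrec_or.comp (const _) ih

theorem primrec_haltInput (c : Code) : Primrec (haltInput c) := by
  refine (const _).pair (Primrec.pair ?_ (const _))
  refine list_cons.comp (const _) (list_cons.comp (const _) (list_cons.comp (const _)
    (list_cons.comp (const _) (list_cons.comp ((const _).pair ?_) (const [])))))
  exact ShapeExpr.primrec_and.comp (const _) (primrec_failureDisj_haltRule _ c)

/-- A code whose halting problem is undecidable. -/
theorem exists_code_not_computablePred :
    ∃ c : Code, ¬ ComputablePred fun n => (c.eval [n]).Dom := by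
  -- A universal function: it runs the `n`th partial recursive program on input 0.
  let f : ℕ →. ℕ := fun n => (Denumerable.ofNat Nat.Partrec.Code n).eval 0
  have hf : Partrec f :=
    Nat.Partrec.Code.eval_part.comp (Computable.ofNat _) (Computable.const 0)
  obtain ⟨c, hc⟩ := Code.exists_code (Nat.Partrec'.part_iff₁.2 hf)
  refine ⟨c, fun h => ComputablePred.halting_problem 0 ?_⟩
  obtain ⟨d, hd, h⟩ := ComputablePred.computable_iff.1 h
  refine ComputablePred.computable_iff.2
    ⟨fun e => d (Encodable.encode e), hd.comp Computable.encode, funext fun e => ?_⟩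
  rw [← congrFun h (Encodable.encode e)]
  have := hc ⟨[Encodable.encode e], rfl⟩
  simp only at this
  rw [this]
  simp [f, List.Vector.head]

theorem DecidableProblem.mono {α : Type*} [Primcodable α] {P P' Q : α → Prop}
    (h : DecidableProblem P Q) (hP : ∀ x, P' x → P x) : DecidableProblem P' Q :=
  let ⟨f, hf, h⟩ := h
  ⟨f, hf, fun x hx => h x (hP x hx)⟩

/-- The partial algorithm becomes total after composition, since the reduction takes values only
where it must halt. -/
theorem DecidableProblem.computablePred_comp {α : Type*} [Primcodable α] {P Q : α → Prop}
    (h : DecidableProblem P Q) {g : ℕ → α} (hg : Computable g) (hP : ∀ n, P (g n)) :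
    ComputablePred fun n => Q (g n) := by
  obtain ⟨f, hf, h⟩ := h
  choose d hd hQ using fun n => h (g n) (hP n)
  exact ComputablePred.computable_iff.2 ⟨d, (hf.comp hg).of_eq_tot hd,
    funext fun n => propext (hQ n).symm⟩

end Computability

theorem not_decidableProblem_stratified :
    ¬ DecidableProblem (fun x : ImplicationInput => x.WellFormed ∧ x.Stratified)
      fun x => x.Implies := by
  intro h
  obtain ⟨c, hc⟩ := exists_code_not_computablePred
  refine hc ?_
  simpa only [implies_haltInput_iff] using h.computablePred_comp (primrec_haltInput c).to_comp
    fun n => ⟨wellFormed_haltInput c n, stratified_haltInput c n⟩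

end SHACL

theorem mainTheorem2 :
    ¬ SHACL.DecidableProblem
        (fun x : SHACL.ImplicationInput => x.WellFormed) (fun x => x.Implies) ∧
    ¬ SHACL.DecidableProblem
        (fun x : SHACL.ImplicationInput => x.WellFormed ∧ x.Stratified) (fun x => x.Implies) :=
  ⟨fun h => SHACL.not_decidableProblem_stratified (h.mono fun _ hx => hx.1),
    SHACL.not_decidableProblem_stratified⟩
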